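/- Let $n\ge 1$ and $\alpha>0$. For $z,w\in\mathbb C^n$ write $z\cdot\overline w=\sum_j z_j\overline{w_j}$ and $|z|^2=z\cdot\overline z$, let $d\lambda_\alpha(z)=(\alpha/\pi)^n e^{-\alpha|z|^2}\,dv(z)$, where $dv$ is Lebesgue measure on $\mathbb C^n$, and let the Fock space $F^2_\alpha$ be the space of entire functions on $\mathbb C^n$ that belong to $L^2(\mathbb C^n,d\lambda_\alpha)$, with the $L^2(d\lambda_\alpha)$ norm. Let $K(z,w)=e^{\alpha z\cdot\overline w}$, and let $\mathcal D\subset F^2_\alpha$ be the (dense) space of all finite linear combinations of the kernel functions $K(\cdot,a)$, $a\in\mathbb C^n$. For $f,g\in F^2_\alpha$ the Toeplitz product $T_fT_{\overline g}$ is defined on $\mathcal D$ by $$T_\varphi u(z)=\int_{\mathbb C^n}\varphi(w)\,u(w)\,e^{\alpha z\cdot\overline w}\,d\lambda_\alpha(w),\qquad T_fT_{\overline g}h=T_f(T_{\overline g}h)\quad(h\in\mathcal D);$$ its values are entire functions, not necessarily in $F^2_\alpha$. It is called compact if it extends from $\mathcal D$ to a compact linear operator on $F^2_\alpha$. For all $f,g\in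 F^2_\alpha$ the following are equivalent: (a) $T_fT_{\overline g}$ is compact; (b) $T_fT_{\overline g}=0$ (on $\mathcal D$); (c) $f=0$ or $g=0$. -/

import Mathlib

open MeasureTheory

noncomputable section

namespace Fock

/-- Complex `n`-space with its Euclidean norm. The inner product `z · w̄ = ∑ zⱼ w̄ⱼ` is
`inner ℂ w z` (Mathlib's inner product is conjugate-linear in the first argument), and `volume`
is Lebesgue measure on `ℂⁿ = ℝ²ⁿ`. -/
abbrev Cn (n : ℕ) : Type := EuclideanSpace ℂ (Fin n)

/-- The Gaussian measure `dλ_α(z) = (α/π)ⁿ exp(-α|z|²) dv(z)`. -/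
def gaussian (n : ℕ) (α : ℝ) : Measure (Cn n) :=
  (volume : Measure (Cn n)).withDensity
    (fun z => ENNReal.ofReal ((α / Real.pi) ^ n * Real.exp (-α * ‖z‖ ^ 2)))

/-- The reproducing kernel `K(z,w) = exp(α z · w̄)`. -/
def kernel {n : ℕ} (α : ℝ) (z w : Cn n) : ℂ :=
  Complex.exp ((α : ℂ) * inner ℂ w z)

/-- The entire functions on `ℂⁿ` that are square integrable for `λ_α`, as a vector space of
functions. -/
def fockSubmodule (n : ℕ) (α : ℝ) : Submodule ℂ (Cn n → ℂ) where
  carrier := {f | Differentiable ℂ f ∧ MemLp f 2 (gaussian n α)}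
  add_mem' hf hg := ⟨hf.1.add hg.1, hf.2.add hg.2⟩
  zero_mem' := ⟨differentiable_const 0, MemLp.zero⟩
  smul_mem' c _ hf := ⟨hf.1.const_smul c, hf.2.const_smul c⟩

/-- The Fock space `F²_α` of `ℂⁿ`. It is a type of its own, so that it carries the `L²` norm
defined below and not the topology of pointwise convergence. -/
def FockSpace (n : ℕ) (α : ℝ) : Type := fockSubmodule n α

instance (n : ℕ) (α : ℝ) : AddCommGroup (FockSpace n α) :=
  inferInstanceAs (AddCommGroup (fockSubmodule n α))

instance (n : ℕ) (α : ℝ) : Module ℂ (FockSpace n α) :=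
  inferInstanceAs (Module ℂ (fockSubmodule n α))

instance (n : ℕ) (α : ℝ) : CoeFun (FockSpace n α) (fun _ => Cn n → ℂ) :=
  ⟨fun f => f.1⟩

/-- The inclusion of the Fock space in `L²(ℂⁿ, dλ_α)`. -/
def toL2 (n : ℕ) (α : ℝ) : FockSpace n α →ₗ[ℂ] Lp ℂ 2 (gaussian n α) where
  toFun f := f.2.2.toLp f.1
  map_add' _ _ := rfl
  map_smul' _ _ := rfl

theorem volume_absolutelyContinuous_gaussian (n : ℕ) {α : ℝ} (hα : 0 < α) :
    (volume : Measure (Cn n)) ≪ gaussian n α := by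
  refine withDensity_absolutelyContinuous' (by fun_prop) (Filter.Eventually.of_forall fun z => ?_)
  have h : 0 < (α / Real.pi) ^ n * Real.exp (-α * ‖z‖ ^ 2) := by positivity
  simpa using h

theorem toL2_injective (n : ℕ) {α : ℝ} (hα : 0 < α) : Function.Injective (toL2 n α) := by
  intro f g hfg
  have h1 : f.1 =ᵐ[gaussian n α] g.1 := (MemLp.toLp_eq_toLp_iff f.2.2 g.2.2).1 hfg
  have h2 : f.1 =ᵐ[volume] g.1 := (volume_absolutelyContinuous_gaussian n hα).ae_le h1
  exact Subtype.ext ((Continuous.ae_eq_iff_eq volume f.2.1.continuous g.2.1.continuous).1 h2)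

/-- The norm of the Fock space is the norm of `L²(ℂⁿ, dλ_α)`. -/
instance (n : ℕ) (α : ℝ) [hα : Fact (0 < α)] : NormedAddCommGroup (FockSpace n α) :=
  NormedAddCommGroup.induced (FockSpace n α) (Lp ℂ 2 (gaussian n α)) (toL2 n α)
    (toL2_injective n hα.out)

instance (n : ℕ) (α : ℝ) [Fact (0 < α)] : NormedSpace ℂ (FockSpace n α) :=
  NormedSpace.induced ℂ (FockSpace n α) (Lp ℂ 2 (gaussian n α)) (toL2 n α)

theorem differentiable_kernel {n : ℕ} (α : ℝ) (a : Cn n) :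
    Differentiable ℂ (fun z => kernel α z a) := by
  unfold kernel
  exact (((innerSL ℂ a).differentiable).const_mul (α : ℂ)).cexp

theorem memLp_kernel {n : ℕ} {α : ℝ} (hα : 0 < α) (a : Cn n) :
    MemLp (fun z => kernel α z a) 2 (gaussian n α) := by
  have hc := (differentiable_kernel α a).continuous
  rw [memLp_two_iff_integrable_sq_norm hc.aestronglyMeasurable, gaussian,
    integrable_withDensity_iff (by fun_prop) (by simp)]
  have h := (GaussianFourier.integrable_cexp_neg_mul_sq_norm_add (V := Cn n) (b := (α : ℂ))
    (by simpa using hα) ((2 * α : ℝ) : ℂ) a).norm.const_mul ((α / Real.pi) ^ n)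
  refine h.congr (Filter.Eventually.of_forall fun z => ?_)
  have hr : (inner ℝ a z : ℝ) = (inner ℂ a z : ℂ).re := by
    simp [PiLp.inner_apply, Complex.inner]
  have hp : 0 ≤ (α / Real.pi) ^ n * Real.exp (-α * ‖z‖ ^ 2) := by positivity
  simp only [kernel, Complex.norm_exp, ENNReal.toReal_ofReal hp, hr]
  rw [← Real.exp_nat_mul, mul_left_comm, ← Real.exp_add]
  congr 2
  simp [← Complex.ofReal_pow]
  ring

/-- The kernel function `K(·,a)` as an element of the Fock space. -/
def kernelFun {n : ℕ} {α : ℝ} [hα : Fact (0 < α)] (a : Cn n) : FockSpace n α :=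
  ⟨fun z => kernel α z a, differentiable_kernel α a, memLp_kernel hα.out a⟩

/-- The space of all finite linear combinations of kernel functions. -/
def kernelSpan (n : ℕ) (α : ℝ) [Fact (0 < α)] : Submodule ℂ (FockSpace n α) :=
  Submodule.span ℂ (Set.range kernelFun)

/-- The Toeplitz operator with symbol `φ`, in integral form:
`T_φ u (z) = ∫ φ(w) u(w) exp(α z · w̄) dλ_α(w)`. -/
def toeplitz {n : ℕ} (α : ℝ) (φ u : Cn n → ℂ) : Cn n → ℂ :=
  fun z => ∫ w, φ w * u w * kernel α z w ∂(gaussian n α)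

/-- The Toeplitz product `T_f T_ḡ`, which is applied to finite linear combinations of kernel
functions; its values are functions on `ℂⁿ` that need not lie in the Fock space. -/
def toeplitzProduct {n : ℕ} {α : ℝ} (f g h : FockSpace n α) : Cn n → ℂ :=
  toeplitz α f (toeplitz α (fun w => starRingEnd ℂ (g w)) h)

/-- `T_f T_ḡ` is compact: it extends from the finite linear combinations of kernel functions to a
compact linear operator on the Fock space. -/
def IsCompactToeplitzProduct {n : ℕ} {α : ℝ} [Fact (0 < α)] (f g : FockSpace n α) : Prop :=
  ∃ S : FockSpace n α →L[ℂ] FockSpace n α,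
    IsCompactOperator S ∧ ∀ h ∈ kernelSpan n α, (S h : Cn n → ℂ) = toeplitzProduct f g h

/-- `T_f T_ḡ = 0` on its domain, the finite linear combinations of kernel functions. -/
def IsZeroToeplitzProduct {n : ℕ} {α : ℝ} [Fact (0 < α)] (f g : FockSpace n α) : Prop :=
  ∀ h ∈ kernelSpan n α, toeplitzProduct f g h = 0

end Fock

end

/-! The nontrivial implication is that compactness forces `f = 0` or `g = 0`. By the reproducing
formula, the product sends `K(·,a)` to `conj (g a) • f K(·,a)` (`toeplitzProduct_kernelFun`). Apply
it to the kernel at `a` divided by its norm and evaluate at `a` with the weight `exp (-α|a|²/2)`: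
the exponentials cancel and the modulus is exactly `|f a| |g a|`, that of the Berezin transform.

On the other side, the weighted modulus of each Fock function tends to zero at infinity
(`tendsto_weightedNorm`), uniformly on compact sets of functions
(`eventually_weightedNorm_lt_of_isCompact`). A compact extension maps the unit ball into such a set,
so the entire function `f g` tends to zero at infinity and vanishes by Liouville. Entire functions
have no zero divisors. -/

noncomputable section

namespace Fock

open Filter Topology Set

/-! ### Mean values against rotation invariant weights -/

section MeanValue

variable {E : Type*} [NormedAddCommGroup E] [NormedSpace ℂ E]

/-- The mean value property of entire functions on circles centred at the origin. -/
theorem integral_comp_rotation {H : E → ℂ} (hH : Differentiable ℂ H) (u : E) :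
    ∫ θ in Ioc 0 (2 * Real.pi), H (Complex.exp (θ * Complex.I) • u) = (2 * Real.pi : ℝ) • H 0 := by
  have hd : Differentiable ℂ (fun t : ℂ => H (t • u)) := hH.comp (by fun_prop)
  have h := (hd.diffContOnCl (s := Metric.ball (0 : ℂ) |1|)).circleAverage
  rw [Real.circleAverage_def, intervalIntegral.integral_of_le (by positivity)] at h
  simp only [circleMap, zero_add, Complex.ofReal_one, one_mul, zero_smul] at h
  rw [← h, smul_smul, mul_inv_cancel₀ (by positivity), one_smul]

/-- The mean value property for a rotation invariant weight. -/
theorem integral_smul_eq_of_rotation_invariant [MeasurableSpace E] [BorelSpace E]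
    [SecondCountableTopology E] {μ : Measure E} [SigmaFinite μ]
    (hμ : ∀ θ : ℝ, MeasurePreserving (fun u : E => Complex.exp (θ * Complex.I) • u) μ μ)
    {w : E → ℝ} (hw : Measurable w)
    (hrot : ∀ (θ : ℝ) (u : E), w (Complex.exp (θ * Complex.I) • u) = w u)
    {H : E → ℂ} (hH : Differentiable ℂ H) (hi : Integrable (fun u => w u • H u) μ) :
    ∫ u, w u • H u ∂μ = (∫ u, w u ∂μ) • H 0 := by
  have hemb (θ : ℝ) : MeasurableEmbedding (fun u : E => Complex.exp (θ * Complex.I) • u) :=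
    (Homeomorph.smulOfNeZero (α := E) _ (Complex.exp_ne_zero (θ * Complex.I))).measurableEmbedding
  have hpi : (0 : ℝ) < 2 * Real.pi := by positivity
  have hslice (θ : ℝ) :
      Integrable (fun u => w u • H (Complex.exp (θ * Complex.I) • u)) μ := by
    have := (hμ θ).integrable_comp_of_integrable hi
    simpa [Function.comp_def, hrot] using this
  have hnorm (θ : ℝ) : ∫ u, ‖w u • H (Complex.exp (θ * Complex.I) • u)‖ ∂μ
      = ∫ u, ‖w u • H u‖ ∂μ := by
    rw [← (hμ θ).integral_comp (hemb θ) (fun u => ‖w u • H u‖)]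
    simp only [hrot]
  have hval (θ : ℝ) : ∫ u, w u • H (Complex.exp (θ * Complex.I) • u) ∂μ
      = ∫ u, w u • H u ∂μ := by
    rw [← (hμ θ).integral_comp (hemb θ) (fun u => w u • H u)]
    simp only [hrot]
  have hc : Continuous H := hH.continuous
  have hm : AEStronglyMeasurable
      (Function.uncurry fun (θ : ℝ) u => w u • H (Complex.exp (θ * Complex.I) • u))
      ((volume.restrict (Ioc 0 (2 * Real.pi))).prod μ) := by
    have h1 : Measurable fun p : ℝ × E => w p.2 := hw.comp measurable_snd
    have h2 : Continuous fun p : ℝ × E => H (Complex.exp (p.1 * Complex.I) • p.2) := by fun_prop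
    exact h1.aestronglyMeasurable.smul h2.aestronglyMeasurable
  have hint : Integrable
      (Function.uncurry fun (θ : ℝ) u => w u • H (Complex.exp (θ * Complex.I) • u))
      ((volume.restrict (Ioc 0 (2 * Real.pi))).prod μ) := by
    rw [integrable_prod_iff hm]
    refine ⟨Eventually.of_forall hslice, ?_⟩
    simp only [Function.uncurry, hnorm]
    exact integrable_const _
  -- Fubini in angle and space: the space integral does not depend on the angle, while the angular
  -- integral at fixed `u` is `2π H 0`.
  have hswap := integral_integral_swap hint
  simp only [hval, integral_smul, integral_comp_rotation hH, integral_const] at hswap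
  have hvol : (volume.restrict (Ioc 0 (2 * Real.pi))).real univ = 2 * Real.pi := by
    simp [hpi.le]
  rw [hvol] at hswap
  rw [integral_smul_const] at hswap
  rw [smul_comm] at hswap
  exact smul_right_injective ℂ hpi.ne' hswap

end MeanValue

/-! ### Gaussian integrals and the reproducing formula -/

variable {n : ℕ} {α : ℝ}

theorem norm_exp_rotation_smul (θ : ℝ) (u : Cn n) : ‖Complex.exp (θ * Complex.I) • u‖ = ‖u‖ := by
  rw [norm_smul, Complex.norm_exp_ofReal_mul_I, one_mul]

theorem measurePreserving_rotation (θ : ℝ) :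
    MeasurePreserving (fun u : Cn n => Complex.exp (θ * Complex.I) • u) volume volume := by
  let e : Cn n ≃ₗ[ℝ] Cn n :=
    (LinearEquiv.smulOfNeZero ℂ (Cn n) _ (Complex.exp_ne_zero (θ * Complex.I))).restrictScalars ℝ
  exact (LinearIsometryEquiv.mk e (norm_exp_rotation_smul θ)).measurePreserving

theorem integral_exp_neg_mul_norm_sq (hα : 0 < α) :
    ∫ u : Cn n, Real.exp (-α * ‖u‖ ^ 2) = ((α / Real.pi) ^ n)⁻¹ := by
  rw [GaussianFourier.integral_rexp_neg_mul_sq_norm hα]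
  have : (Module.finrank ℝ (Cn n) : ℝ) / 2 = (n : ℕ) := by
    rw [← Module.finrank_mul_finrank ℝ ℂ (Cn n)]
    simp
  rw [this, Real.rpow_natCast, ← inv_pow, inv_div]

theorem integral_gaussian (hα : 0 < α) {V : Type*} [NormedAddCommGroup V] [NormedSpace ℝ V]
    (F : Cn n → V) :
    ∫ w, F w ∂(gaussian n α)
      = (α / Real.pi) ^ n • ∫ w, Real.exp (-α * ‖w‖ ^ 2) • F w := by
  rw [gaussian, integral_withDensity_eq_integral_toReal_smul (by fun_prop) (by simp),
    ← integral_smul]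
  congr 1 with w
  rw [ENNReal.toReal_ofReal (by positivity), smul_smul]

theorem integrable_gaussian_iff (hα : 0 < α) {V : Type*} [NormedAddCommGroup V] [NormedSpace ℝ V]
    {F : Cn n → V} :
    Integrable F (gaussian n α) ↔ Integrable (fun w => Real.exp (-α * ‖w‖ ^ 2) • F w) := by
  have hc : (α / Real.pi) ^ n ≠ 0 := by positivity
  rw [gaussian, integrable_withDensity_iff_integrable_smul' (by fun_prop) (by simp),
    ← integrable_smul_iff hc (f := fun w => Real.exp (-α * ‖w‖ ^ 2) • F w)]
  refine integrable_congr (Eventually.of_forall fun w => ?_)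
  simp only [Pi.smul_apply]
  rw [ENNReal.toReal_ofReal (by positivity), smul_smul]

theorem norm_kernel (z w : Cn n) : ‖kernel α z w‖ = Real.exp (α * (inner ℂ w z).re) := by
  simp [kernel, Complex.norm_exp]

theorem norm_add_sq_complex (a u : Cn n) :
    ‖a + u‖ ^ 2 = ‖a‖ ^ 2 + 2 * (inner ℂ a u).re + ‖u‖ ^ 2 := by
  have := norm_add_sq (𝕜 := ℂ) a u
  simpa using this

/-- The Gaussian weight at `a + u`, against the kernel, is a Gaussian weight at `u` times a
function that is holomorphic in `u`. -/
theorem exp_smul_kernel_add (a u : Cn n) :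
    (Real.exp (-α * ‖a + u‖ ^ 2) : ℂ) * kernel α a (a + u)
      = Real.exp (-α * ‖u‖ ^ 2) * Complex.exp (-α * inner ℂ a u) := by
  have h1 : ((‖a + u‖ ^ 2 : ℝ) : ℂ) = inner ℂ (a + u) (a + u) := by
    rw [inner_self_eq_norm_sq_to_K]; simp
  have h2 : ((‖u‖ ^ 2 : ℝ) : ℂ) = inner ℂ u u := by
    rw [inner_self_eq_norm_sq_to_K]; simp
  rw [kernel, Complex.ofReal_exp, Complex.ofReal_exp, ← Complex.exp_add, ← Complex.exp_add]
  congr 1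
  rw [Complex.ofReal_mul, Complex.ofReal_mul, h1, h2]
  simp only [inner_add_left, inner_add_right]
  push_cast
  ring

theorem differentiable_exp_inner (c : ℂ) (a : Cn n) :
    Differentiable ℂ (fun u => Complex.exp (c * inner ℂ a u)) :=
  (((innerSL ℂ a).differentiable).const_mul c).cexp

/-- The reproducing formula, for entire functions for which the integral converges. -/
theorem integral_mul_kernel (hα : 0 < α) {F : Cn n → ℂ} (hF : Differentiable ℂ F) (z : Cn n)
    (hi : Integrable (fun w => F w * kernel α z w) (gaussian n α)) :
    ∫ w, F w * kernel α z w ∂(gaussian n α) = F z := by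
  rw [integrable_gaussian_iff hα] at hi
  rw [integral_gaussian hα]
  -- Recentring at `z` leaves a radial Gaussian times a holomorphic function of `u`, whose mean is
  -- its value at `u = 0`.
  have hshift (u : Cn n) : Real.exp (-α * ‖z + u‖ ^ 2) • (F (z + u) * kernel α z (z + u))
      = Real.exp (-α * ‖u‖ ^ 2) • (F (z + u) * Complex.exp (-α * inner ℂ z u)) := by
    rw [Complex.real_smul, Complex.real_smul, mul_left_comm, exp_smul_kernel_add]
    ring
  rw [← integral_add_left_eq_self _ z]
  have hi' := hi.comp_add_left z
  simp only [hshift] at hi' ⊢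
  have hd : Differentiable ℂ (fun u => F (z + u) * Complex.exp (-α * inner ℂ z u)) :=
    (hF.comp (by fun_prop)).mul (differentiable_exp_inner _ z)
  rw [integral_smul_eq_of_rotation_invariant measurePreserving_rotation (by fun_prop)
    (fun θ u => by rw [norm_exp_rotation_smul]) hd hi', integral_exp_neg_mul_norm_sq hα, smul_smul,
    mul_inv_cancel₀ (by positivity)]
  simp

theorem differentiable_coe (f : FockSpace n α) : Differentiable ℂ (f : Cn n → ℂ) := f.2.1

theorem memLp_coe (f : FockSpace n α) : MemLp (f : Cn n → ℂ) 2 (gaussian n α) := f.2.2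

/-- The two kernels together have the modulus of the single kernel at `a + z`, so this is a product
of two `L²` functions. Membership of `f K(·,a)` in `L²` is not needed. -/
theorem integrable_mul_kernel_mul_kernel (hα : 0 < α) (f : FockSpace n α) (a z : Cn n) :
    Integrable (fun w => f w * kernel α w a * kernel α z w) (gaussian n α) := by
  have hi := (memLp_coe f).integrable_mul (memLp_kernel hα (a + z))
  refine hi.mono ?_ (Eventually.of_forall fun w => le_of_eq ?_)
  · refine Continuous.aestronglyMeasurable ?_
    have h1 := (differentiable_coe f).continuous
    have h2 := (differentiable_kernel α a).continuous
    have h3 : Continuous (fun w => kernel α z w) := by unfold kernel; fun_prop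
    fun_prop
  · simp only [norm_mul, Pi.mul_apply, norm_kernel, inner_add_left, Complex.add_re, mul_add,
      Real.exp_add]
    rw [← inner_conj_symm w z, Complex.conj_re, mul_assoc]

theorem integral_mul_kernel_mul_kernel (hα : 0 < α) (f : FockSpace n α) (a z : Cn n) :
    ∫ w, f w * kernel α w a * kernel α z w ∂(gaussian n α) = f z * kernel α z a :=
  integral_mul_kernel hα ((differentiable_coe f).mul (differentiable_kernel α a)) z
    (integrable_mul_kernel_mul_kernel hα f a z)

/-! ### Toeplitz operators on kernel functions -/

theorem conj_kernel (z w : Cn n) : starRingEnd ℂ (kernel α z w) = kernel α w z := by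
  simp [kernel, ← Complex.exp_conj]

theorem toeplitz_kernel (hα : 0 < α) (f : FockSpace n α) (a z : Cn n) :
    toeplitz α f (fun w => kernel α w a) z = f z * kernel α z a :=
  integral_mul_kernel_mul_kernel hα f a z

/-- This is the conjugate of the reproducing formula for `g`, with `a` and `z` exchanged. -/
theorem toeplitz_conj_kernel (hα : 0 < α) (g : FockSpace n α) (a z : Cn n) :
    toeplitz α (fun w => starRingEnd ℂ (g w)) (fun w => kernel α w a) z
      = starRingEnd ℂ (g a) * kernel α z a := by
  have h := congrArg (starRingEnd ℂ) (integral_mul_kernel_mul_kernel hα g z a)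
  rw [← integral_conj] at h
  simp only [map_mul, conj_kernel] at h
  rw [← h, toeplitz]
  congr 1 with w
  ring

theorem toeplitz_const_mul (φ u : Cn n → ℂ) (c : ℂ) (z : Cn n) :
    toeplitz α φ (fun w => c * u w) z = c * toeplitz α φ u z := by
  rw [toeplitz, toeplitz, ← integral_const_mul]
  congr 1 with w
  ring

/-- `T_f T_ḡ K(·,a) = conj (g a) f K(·,a)`. -/
theorem toeplitzProduct_kernelFun [hα : Fact (0 < α)] (f g : FockSpace n α) (a z : Cn n) :
    toeplitzProduct f g (kernelFun a) z = starRingEnd ℂ (g a) * (f z * kernel α z a) := by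
  have h : toeplitz α (fun w => starRingEnd ℂ (g w)) (kernelFun a : FockSpace n α)
      = fun z => starRingEnd ℂ (g a) * kernel α z a :=
    funext (toeplitz_conj_kernel hα.out g a)
  rw [toeplitzProduct, h, toeplitz_const_mul, toeplitz_kernel hα.out]

/-! ### Pointwise bounds and decay at infinity -/

theorem norm_sq_eq_integral [hα : Fact (0 < α)] (h : FockSpace n α) :
    ‖h‖ ^ 2 = ∫ w, ‖h w‖ ^ 2 ∂(gaussian n α) := by
  have h1 : ‖h‖ = ‖(memLp_coe h).toLp‖ := rfl
  rw [h1, Lp.norm_toLp, (memLp_coe h).eLpNorm_eq_integral_rpow_norm (by simp) (by simp),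
    ENNReal.toReal_ofReal (by positivity), ← Real.rpow_natCast, ← Real.rpow_mul (by positivity)]
  simp

theorem integrable_norm_sq (hα : 0 < α) (h : FockSpace n α) :
    Integrable (fun w => Real.exp (-α * ‖w‖ ^ 2) * ‖h w‖ ^ 2) := by
  have := (memLp_two_iff_integrable_sq_norm
    (differentiable_coe h).continuous.aestronglyMeasurable).1 (memLp_coe h)
  exact (integrable_gaussian_iff hα).1 this

/-- The sub-mean value inequality for the squared weighted modulus, over the translates of a
rotation invariant set. -/
theorem norm_sq_le_setIntegral (hα : 0 < α) (h : FockSpace n α) {s : Set (Cn n)}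
    (hs : MeasurableSet s)
    (hrot : ∀ (θ : ℝ) (u : Cn n), Complex.exp (θ * Complex.I) • u ∈ s ↔ u ∈ s) (a : Cn n) :
    (∫ u in s, Real.exp (-α * ‖u‖ ^ 2)) * (Real.exp (-α * ‖a‖ ^ 2) * ‖h a‖ ^ 2)
      ≤ ∫ u in s, Real.exp (-α * ‖a + u‖ ^ 2) * ‖h (a + u)‖ ^ 2 := by
  set w : Cn n → ℝ := s.indicator fun u => Real.exp (-α * ‖u‖ ^ 2) with hw
  set H : Cn n → ℂ := fun u => (h (a + u) * Complex.exp (-α * inner ℂ a u)) ^ 2 with hHdef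
  have hwm : Measurable w := Measurable.indicator (by fun_prop) hs
  have hwrot (θ : ℝ) (u : Cn n) : w (Complex.exp (θ * Complex.I) • u) = w u := by
    by_cases hu : u ∈ s
    · rw [hw, indicator_of_mem ((hrot θ u).2 hu), indicator_of_mem hu, norm_exp_rotation_smul]
    · rw [hw, indicator_of_notMem (mt (hrot θ u).1 hu), indicator_of_notMem hu]
  -- `H` is chosen holomorphic with `|H u| exp (-α|u|²)` equal to `exp (α|a|²)` times the weighted
  -- squared modulus of `h` at `a + u`.
  have hH : Differentiable ℂ H :=
    (((differentiable_coe h).comp (by fun_prop)).mul (differentiable_exp_inner _ a)).pow 2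
  have hnorm (u : Cn n) : ‖w u • H u‖ = s.indicator (fun u => Real.exp (α * ‖a‖ ^ 2) *
      (Real.exp (-α * ‖a + u‖ ^ 2) * ‖h (a + u)‖ ^ 2)) u := by
    by_cases hu : u ∈ s
    · simp only [hw, hHdef, indicator_of_mem hu, norm_smul, norm_pow, norm_mul, Complex.norm_exp,
        Real.norm_eq_abs, Real.abs_exp, mul_pow, norm_add_sq_complex]
      rw [← Real.exp_nat_mul, ← mul_assoc (Real.exp (α * _)), ← Real.exp_add, mul_left_comm,
        ← Real.exp_add, mul_comm]
      congr 2
      simp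
      ring
    · simp [hw, hu]
  have hi : Integrable (fun u => w u • H u) := by
    refine (integrable_norm_iff ?_).1 ?_
    · exact hwm.aestronglyMeasurable.smul hH.continuous.aestronglyMeasurable
    · simp only [hnorm]
      exact ((((integrable_norm_sq hα h).comp_add_left a).const_mul _)).indicator hs
  have key := integral_smul_eq_of_rotation_invariant measurePreserving_rotation hwm hwrot hH hi
  have hle := norm_integral_le_integral_norm (μ := volume) (fun u => w u • H u)
  rw [key] at hle
  simp only [hnorm] at hle
  rw [hw, integral_indicator hs, integral_indicator hs, integral_const_mul] at hle
  have hH0 : H 0 = h a ^ 2 := by simp [hHdef]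
  rw [hH0, norm_smul, norm_pow, Real.norm_of_nonneg (by positivity)] at hle
  have hpos := Real.exp_pos (-α * ‖a‖ ^ 2)
  have := mul_le_mul_of_nonneg_left hle hpos.le
  rw [← mul_assoc (Real.exp _) (Real.exp _), ← Real.exp_add] at this
  simpa [mul_left_comm] using this

/-- The modulus of `h`, weighted by the norm of the kernel function. -/
def weightedNorm (h : FockSpace n α) (a : Cn n) : ℝ :=
  Real.exp (-α * ‖a‖ ^ 2 / 2) * ‖h a‖

theorem weightedNorm_sq (h : FockSpace n α) (a : Cn n) :
    weightedNorm h a ^ 2 = Real.exp (-α * ‖a‖ ^ 2) * ‖h a‖ ^ 2 := by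
  rw [weightedNorm, mul_pow, ← Real.exp_nat_mul]
  congr 2
  push_cast
  ring

theorem weightedNorm_nonneg (h : FockSpace n α) (a : Cn n) : 0 ≤ weightedNorm h a := by
  unfold weightedNorm; positivity

theorem weightedNorm_le_norm [hα : Fact (0 < α)] (h : FockSpace n α) (a : Cn n) :
    weightedNorm h a ≤ ‖h‖ := by
  have hα' := hα.out
  have h1 := norm_sq_le_setIntegral hα.out h MeasurableSet.univ (by simp) a
  rw [← weightedNorm_sq] at h1
  simp only [Measure.restrict_univ] at h1
  rw [integral_add_left_eq_self (fun u => Real.exp (-α * ‖u‖ ^ 2) * ‖h u‖ ^ 2),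
    integral_exp_neg_mul_norm_sq hα.out, inv_mul_le_iff₀ (by positivity)] at h1
  refine le_of_sq_le_sq ?_ (norm_nonneg h)
  rw [norm_sq_eq_integral, integral_gaussian hα.out]
  simpa using h1

theorem weightedNorm_le_add [hα : Fact (0 < α)] (h k : FockSpace n α) (a : Cn n) :
    weightedNorm h a ≤ ‖h - k‖ + weightedNorm k a := by
  refine le_trans ?_ (add_le_add_left (weightedNorm_le_norm (h - k) a) _)
  have : (h - k : FockSpace n α) a = h a - k a := rfl
  rw [weightedNorm, weightedNorm, weightedNorm, ← mul_add, this]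
  gcongr
  simpa using norm_add_le (h a - k a) (k a)

/-- The weighted square at `a` is controlled by the mass of an integrable function on the unit ball
around `a`, and that ball eventually leaves every fixed point. -/
theorem tendsto_weightedNorm (hα : 0 < α) (h : FockSpace n α) :
    Tendsto (weightedNorm h) (cocompact (Cn n)) (𝓝 0) := by
  set ψ : Cn n → ℝ := fun w => Real.exp (-α * ‖w‖ ^ 2) * ‖h w‖ ^ 2 with hψ
  have hψi : Integrable ψ := integrable_norm_sq hα h
  set B : Set (Cn n) := Metric.ball 0 1 with hB
  have hBm : MeasurableSet B := Metric.isOpen_ball.measurableSet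
  have hlim : Tendsto (fun a => ∫ u in B, ψ (a + u)) (cocompact (Cn n)) (𝓝 0) := by
    have hsub (a : Cn n) :
        ∫ u in B, ψ (a + u) = ∫ w, (Metric.ball a 1).indicator ψ w := by
      rw [← integral_indicator hBm,
        ← integral_add_left_eq_self ((Metric.ball a 1).indicator ψ) a]
      congr 1 with u
      simp [indicator, hB]
    simp only [hsub]
    have hpt : ∀ w : Cn n,
        Tendsto (fun a => (Metric.ball a 1).indicator ψ w) (cocompact (Cn n)) (𝓝 0) := by
      intro w
      refine tendsto_const_nhds.congr' ?_
      filter_upwards [(isCompact_closedBall w 1).compl_mem_cocompact] with a ha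
      rw [indicator_of_notMem]
      intro hw
      exact ha (Metric.mem_closedBall'.2 (Metric.mem_ball.1 hw).le)
    have : (cocompact (Cn n)).IsCountablyGenerated := by
      rw [← Metric.cobounded_eq_cocompact, ← comap_norm_atTop]
      infer_instance
    have := tendsto_integral_filter_of_dominated_convergence (μ := (volume : Measure (Cn n)))
      (l := cocompact (Cn n)) (F := fun a => (Metric.ball a 1).indicator ψ) (f := fun _ => 0)
      (fun w => ‖ψ w‖)
      (Eventually.of_forall fun a =>
        (hψi.indicator Metric.isOpen_ball.measurableSet).aestronglyMeasurable)
      (Eventually.of_forall fun a => Eventually.of_forall fun w => norm_indicator_le_norm_self _ _)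
      hψi.norm (Eventually.of_forall hpt)
    simpa using this
  set c : ℝ := ∫ u in B, Real.exp (-α * ‖u‖ ^ 2) with hc
  have hcpos : 0 < c := by
    have hexp : Integrable (fun u : Cn n => Real.exp (-α * ‖u‖ ^ 2)) := by
      refine Integrable.of_integral_ne_zero ?_
      rw [integral_exp_neg_mul_norm_sq hα]
      positivity
    rw [hc, setIntegral_pos_iff_support_of_nonneg_ae
      (Eventually.of_forall fun u => (Real.exp_pos _).le) hexp.integrableOn]
    have : Function.support (fun u : Cn n => Real.exp (-α * ‖u‖ ^ 2)) = univ := by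
      ext u; simp [Real.exp_ne_zero]
    rw [this, univ_inter]
    exact Metric.measure_ball_pos _ _ one_pos
  have hsq : Tendsto (fun a => weightedNorm h a ^ 2) (cocompact (Cn n)) (𝓝 0) := by
    have hlim' := hlim.const_mul c⁻¹
    rw [mul_zero] at hlim'
    refine squeeze_zero (fun a => sq_nonneg _) (fun a => ?_) hlim'
    have := norm_sq_le_setIntegral hα h hBm (fun θ u => by
      simp only [hB, mem_ball_zero_iff, norm_exp_rotation_smul]) a
    rw [← weightedNorm_sq] at this
    exact (le_inv_mul_iff₀ hcpos).2 this
  have := hsq.sqrt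
  simpa [Real.sqrt_sq (weightedNorm_nonneg h _)] using this

/-- A finite `ε/2`-net suffices, since point evaluation with the weight is bounded by the norm,
uniformly in `a`. -/
theorem eventually_weightedNorm_lt_of_isCompact [hα : Fact (0 < α)] {C : Set (FockSpace n α)}
    (hC : IsCompact C) {ε : ℝ} (hε : 0 < ε) :
    ∀ᶠ a in cocompact (Cn n), ∀ h ∈ C, weightedNorm h a < ε := by
  obtain ⟨t, -, htf, hcov⟩ := hC.finite_cover_balls (half_pos hε)
  have hev : ∀ᶠ a in cocompact (Cn n), ∀ k ∈ t, weightedNorm k a < ε / 2 :=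
    (eventually_all_finite htf).2 fun k _ =>
      (tendsto_weightedNorm hα.out k).eventually_lt_const (half_pos hε)
  filter_upwards [hev] with a ha h hh
  obtain ⟨k, hk, hhk⟩ := mem_iUnion₂.1 (hcov hh)
  rw [mem_ball_iff_norm] at hhk
  linarith [weightedNorm_le_add h k a, ha k hk]

/-! ### Compactness and the Berezin transform -/

theorem norm_kernel_self (a : Cn n) : ‖kernel α a a‖ = Real.exp (α * ‖a‖ ^ 2) := by
  rw [norm_kernel, inner_self_eq_norm_sq_to_K]
  simp [← Complex.ofReal_pow]

theorem norm_kernelFun [hα : Fact (0 < α)] (a : Cn n) :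
    ‖(kernelFun a : FockSpace n α)‖ = Real.exp (α * ‖a‖ ^ 2 / 2) := by
  have h0 : ∀ w, kernel α w (0 : Cn n) = 1 := fun w => by simp [kernel]
  -- Since `K(·,0) = 1`, the parameter `0` gives the plain reproducing formula.
  have hk := integral_mul_kernel_mul_kernel hα.out (kernelFun a : FockSpace n α) 0 a
  have hsq : ‖(kernelFun a : FockSpace n α)‖ ^ 2 = Real.exp (α * ‖a‖ ^ 2 / 2) ^ 2 := by
    rw [norm_sq_eq_integral, ← Real.exp_nat_mul, ← Complex.ofReal_inj, ← integral_complex_ofReal]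
    simp only [h0, mul_one] at hk
    have hpt (w : Cn n) : ((‖(kernelFun a : FockSpace n α) w‖ ^ 2 : ℝ) : ℂ)
        = (kernelFun a : FockSpace n α) w * kernel α a w := by
      rw [← conj_kernel w a, Complex.ofReal_pow]
      exact (Complex.mul_conj' _).symm
    simp only [hpt, hk]
    change kernel α a a = _
    rw [kernel, inner_self_eq_norm_sq_to_K, Complex.ofReal_exp]
    congr 1
    push_cast
    simp
    ring
  exact (pow_left_inj₀ (norm_nonneg _) (Real.exp_pos _).le two_ne_zero).1 hsq

theorem tendsto_mul_of_isCompact [hα : Fact (0 < α)] {f g : FockSpace n α}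
    (hfg : IsCompactToeplitzProduct f g) :
    Tendsto (fun a => f a * g a) (cocompact (Cn n)) (𝓝 0) := by
  obtain ⟨S, hS, hSh⟩ := hfg
  obtain ⟨C, hC, hSC⟩ := IsCompactOperator.image_closedBall_subset_compact
    (f := (S : FockSpace n α →ₗ[ℂ] FockSpace n α)) hS 1
  rw [Metric.tendsto_nhds]
  intro ε hε
  filter_upwards [eventually_weightedNorm_lt_of_isCompact hC hε] with a ha
  set k : FockSpace n α := ((Real.exp (-α * ‖a‖ ^ 2 / 2) : ℝ) : ℂ) • kernelFun a with hk
  have hk1 : ‖k‖ ≤ 1 := by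
    rw [hk, norm_smul, norm_kernelFun, Complex.norm_real, Real.norm_of_nonneg (Real.exp_pos _).le,
      ← Real.exp_add]
    refine (Real.exp_eq_one_iff _).2 ?_ |>.le
    ring
  have hlt := ha (S k) (hSC ⟨k, mem_closedBall_zero_iff.2 hk1, rfl⟩)
  have hval : (S k : FockSpace n α) a = ((Real.exp (-α * ‖a‖ ^ 2 / 2) : ℝ) : ℂ)
      * (starRingEnd ℂ (g a) * (f a * kernel α a a)) := by
    rw [hk, map_smul, ← toeplitzProduct_kernelFun f g a a,
      ← hSh _ (Submodule.subset_span (mem_range_self a))]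
    rfl
  rw [weightedNorm, hval] at hlt
  simp only [norm_mul, Complex.norm_real, Real.norm_of_nonneg (Real.exp_pos _).le,
    RCLike.norm_conj, norm_kernel_self] at hlt
  rw [dist_zero_right, norm_mul]
  convert hlt using 1
  -- One half-Gaussian normalizes the kernel, the other is the evaluation weight; together they
  -- cancel `K(a,a)`.
  have he : Real.exp (-α * ‖a‖ ^ 2 / 2) * Real.exp (-α * ‖a‖ ^ 2 / 2) * Real.exp (α * ‖a‖ ^ 2)
      = 1 := by
    rw [← Real.exp_add, ← Real.exp_add, Real.exp_eq_one_iff]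
    ring
  linear_combination (-‖f a‖ * ‖g a‖) * he

/-! ### Zero divisors and conclusion -/

/-- The ring of entire functions on a complex normed space has no zero divisors. -/
theorem eq_zero_or_eq_zero_of_differentiable_mul_eq_zero {E : Type*} [NormedAddCommGroup E]
    [NormedSpace ℂ E] {f g : E → ℂ} (hf : Differentiable ℂ f) (hg : Differentiable ℂ g)
    (hfg : ∀ z, f z * g z = 0) : f = 0 ∨ g = 0 := by
  by_contra! hne
  obtain ⟨p, hp⟩ := Function.ne_iff.1 hne.1
  obtain ⟨q, hq⟩ := Function.ne_iff.1 hne.2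
  -- On the complex line from `p` to `q`, `g` vanishes near `t = 0`, where `f` does not; the
  -- identity theorem carries this to `t = 1`.
  have hline : Differentiable ℂ (fun t : ℂ => p + t • (q - p)) := by fun_prop
  have hft : Differentiable ℂ (fun t : ℂ => f (p + t • (q - p))) := hf.comp hline
  have hgt : Differentiable ℂ (fun t : ℂ => g (p + t • (q - p))) := hg.comp hline
  have hev : ∀ᶠ t in 𝓝 (0 : ℂ), g (p + t • (q - p)) = 0 := by
    filter_upwards [hft.continuous.continuousAt.eventually_ne (y := 0) (by simpa using hp)]
      with t ht
    exact (mul_eq_zero.1 (hfg _)).resolve_left ht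
  have hz := AnalyticOnNhd.eq_of_eventuallyEq (fun t _ => hgt.analyticAt t)
    (fun _ _ => analyticAt_const) hev
  exact hq (by simpa using congrFun hz 1)

theorem eq_zero_or_eq_zero_of_isCompact [hα : Fact (0 < α)] (hn : 1 ≤ n) {f g : FockSpace n α}
    (hfg : IsCompactToeplitzProduct f g) : f = 0 ∨ g = 0 := by
  -- For `n = 0` the space is a point and a limit along `cocompact` says nothing.
  have : Nonempty (Fin n) := ⟨⟨0, hn⟩⟩
  have hz : ∀ z, f z * g z = 0 := fun z =>
    ((differentiable_coe f).mul (differentiable_coe g)).apply_eq_of_tendsto_cocompact z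
      (tendsto_mul_of_isCompact hfg)
  exact (eq_zero_or_eq_zero_of_differentiable_mul_eq_zero (differentiable_coe f)
    (differentiable_coe g) hz).imp (fun h => Subtype.ext h) (fun h => Subtype.ext h)

theorem isZeroToeplitzProduct_of_eq_zero [Fact (0 < α)] {f g : FockSpace n α}
    (hfg : f = 0 ∨ g = 0) : IsZeroToeplitzProduct f g := by
  have h0 (z : Cn n) : (0 : FockSpace n α) z = 0 := rfl
  intro h _
  ext z
  rcases hfg with rfl | rfl <;> simp [toeplitzProduct, toeplitz, h0]

theorem isCompactToeplitzProduct_of_isZero [Fact (0 < α)] {f g : FockSpace n α}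
    (hfg : IsZeroToeplitzProduct f g) : IsCompactToeplitzProduct f g :=
  ⟨0, isCompactOperator_zero, fun h hh => (hfg h hh).symm⟩

end Fock

end

theorem mainTheorem3 (n : ℕ) (hn : 1 ≤ n) (α : ℝ) [Fact (0 < α)] (f g : Fock.FockSpace n α) :
    List.TFAE [Fock.IsCompactToeplitzProduct f g,
      Fock.IsZeroToeplitzProduct f g,
      f = 0 ∨ g = 0] := by
  tfae_have 1 → 3 := Fock.eq_zero_or_eq_zero_of_isCompact hn
  tfae_have 3 → 2 := Fock.isZeroToeplitzProduct_of_eq_zero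
  tfae_have 2 → 1 := Fock.isCompactToeplitzProduct_of_isZero
  tfae_finish
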